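/- Let $\mathcal T$ be Bourbaki's theory of sets (1970 edition), that is, the following formal system. Terms and relations are the well-formed assemblies built from letters and the signs $\tau,\vee,\neg,=,\in$; for a letter $x$ and a relation $R$, $\tau_x(R)$ denotes the term obtained by replacing $x$ in $R$ by boxes linked to the initial sign $\tau$, and $(T|x)R$ denotes the result of replacing $x$ by the term $T$ in $R$. One puts $R\Rightarrow S :\equiv (\neg R)\vee S$, $(\exists x)R:\equiv(\tau_x(R)|x)R$, $(\forall x)R:\equiv\neg(\exists x)\neg R$. The axioms are all instances of the schemes S1--S4 of propositional logic, S5: $(T|x)R\Rightarrow(\exists x)R$, S6: $T=U\Rightarrow((T|x)R\Leftrightarrow(U|x)R)$, S7: $((\forall x)(R\Leftrightarrow S))\Rightarrow(\tau_x(R)=\tau_x(S))$, S8 (selection and union): $(\forall y)(\exists X)(\forall x)(R\Rightarrow x\in X)\Rightarrow(\forall Y)\,\mathrm{Coll}_x((\exists y)(y\in Y\text{ and }R))$, where $x\neq y$ and $X,Y$ are distinct from $x,y$ and do not occur in $R$, and $\mathrm{Coll}_x(S)$ says that the objects $x$ satisfying $S$ are the elements of a set; together with the explicit axioms of extent, of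 the two-element set, of the set of subsets, and of infinity. The theorems of $\mathcal T$ are the relations obtained from the axioms by the rule: from $R$ and $R\Rightarrow S$ infer $S$. Theorem. For every letter $x$, the relation $$\tau_x(x=x)=\tau_x(x\neq x)$$ is undecidable in $\mathcal T$: neither this relation nor its negation is a theorem of $\mathcal T$. -/

import Mathlib

/-! Bourbaki's formal language and theory of sets (edition of 1970: the specific signs are
`=` and `∈`, and ordered pairs are Kuratowski pairs). -/

namespace Bourbaki

/-- The two sorts of well-formed assemblies. -/
inductive Kind
  | term
  | relation

/-- Well-formed assemblies built from letters and the signs `τ`, `∨`, `¬`, `=`, `∈`.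
Bourbaki's boxes `□`, each linked to an occurrence of `τ`, are written `box i`: the box is linked
to the `i`-th enclosing `τ`, counted from the inside and starting from `0`.
In `Assembly k n` at most `n` enclosing `τ` may be missing. -/
inductive Assembly : Kind → ℕ → Type
  | letter {n : ℕ} (x : ℕ) : Assembly Kind.term n
  | box {n : ℕ} (i : Fin n) : Assembly Kind.term n
  | tau {n : ℕ} (R : Assembly Kind.relation (n + 1)) : Assembly Kind.term n
  | or {n : ℕ} (R S : Assembly Kind.relation n) : Assembly Kind.relation n
  | not {n : ℕ} (R : Assembly Kind.relation n) : Assembly Kind.relation n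
  | eq {n : ℕ} (T U : Assembly Kind.term n) : Assembly Kind.relation n
  | mem {n : ℕ} (T U : Assembly Kind.term n) : Assembly Kind.relation n

namespace Assembly

/-- The same assembly, read inside further enclosing `τ`s (none of its boxes is linked to them). -/
def lift : {k : Kind} → {n m : ℕ} → n ≤ m → Assembly k n → Assembly k m
  | _, _, _, _, letter x => letter x
  | _, _, _, h, box i => box (Fin.castLE h i)
  | _, _, _, h, tau R => tau (lift (Nat.succ_le_succ h) R)
  | _, _, _, h, or R S => or (lift h R) (lift h S)
  | _, _, _, h, not R => not (lift h R)
  | _, _, _, h, eq T U => eq (lift h T) (lift h U)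
  | _, _, _, h, mem T U => mem (lift h T) (lift h U)

/-- `(T|x)A`: the term `T` replaces the letter `x` in `A`. -/
def subst (T : Assembly Kind.term 0) (x : ℕ) : {k : Kind} → {n : ℕ} → Assembly k n → Assembly k n
  | _, n, letter y => if y = x then lift (Nat.zero_le n) T else letter y
  | _, _, box i => box i
  | _, _, tau R => tau (subst T x R)
  | _, _, or R S => or (subst T x R) (subst T x S)
  | _, _, not R => not (subst T x R)
  | _, _, eq U V => eq (subst T x U) (subst T x V)
  | _, _, mem U V => mem (subst T x U) (subst T x V)

/-- Replace the letter `x` by a box linked to one new, outermost `τ`. -/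
def link (x : ℕ) : {k : Kind} → {n : ℕ} → Assembly k n → Assembly k (n + 1)
  | _, n, letter y => if y = x then box (Fin.last n) else letter y
  | _, _, box i => box (Fin.castSucc i)
  | _, _, tau R => tau (link x R)
  | _, _, or R S => or (link x R) (link x S)
  | _, _, not R => not (link x R)
  | _, _, eq T U => eq (link x T) (link x U)
  | _, _, mem T U => mem (link x T) (link x U)

/-- The letters that occur in an assembly. -/
def letters : {k : Kind} → {n : ℕ} → Assembly k n → Finset ℕ
  | _, _, letter x => {x}
  | _, _, box _ => ∅
  | _, _, tau R => letters R
  | _, _, or R S => letters R ∪ letters S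
  | _, _, not R => letters R
  | _, _, eq T U => letters T ∪ letters U
  | _, _, mem T U => letters T ∪ letters U

end Assembly

/-- Terms: every box is linked to some `τ`. -/
abbrev Term : Type := Assembly Kind.term 0

/-- Relations: every box is linked to some `τ`. -/
abbrev Relation : Type := Assembly Kind.relation 0

open Assembly

/-- A letter outside the finite set `s`. -/
def fresh (s : Finset ℕ) : ℕ := s.sup id + 1

/-- The letter `x` as a term. -/
abbrev var (x : ℕ) : Term := letter x

/-- `τ_x(R)`. -/
def tauOf (x : ℕ) (R : Relation) : Term := tau (link x R)

/-- `R ⇒ S`. -/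
def imp (R S : Relation) : Relation := or (not R) S

/-- `R and S`. -/
def conj (R S : Relation) : Relation := not (or (not R) (not S))

/-- `R ⇔ S`. -/
def equ (R S : Relation) : Relation := conj (imp R S) (imp S R)

/-- `T ≠ U`. -/
def ne (T U : Term) : Relation := not (eq T U)

/-- `(∃x)R`, which is `(τ_x(R)|x)R`. -/
def ex (x : ℕ) (R : Relation) : Relation := subst (tauOf x R) x R

/-- `(∀x)R`, which is `not (∃x)(not R)`. -/
def all (x : ℕ) (R : Relation) : Relation := not (ex x (not R))

/-- There is one and only one `x` such that `R`. -/
def exUnique (x : ℕ) (R : Relation) : Relation :=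
  let y := fresh (insert x R.letters)
  let z := fresh (insert y (insert x R.letters))
  conj (ex x R)
    (all y (all z (imp (conj (subst (var y) x R) (subst (var z) x R)) (eq (var y) (var z)))))

/-- `Coll_x(R)`: the relation `R` is collectivizing in `x`. -/
def coll (x : ℕ) (R : Relation) : Relation :=
  let y := fresh (insert x R.letters)
  ex y (all x (equ (mem (var x) (var y)) R))

/-- The set of all `x` such that `R`: the term `τ_y((∀x)((x ∈ y) ⇔ R))`. -/
def setOf (x : ℕ) (R : Relation) : Term :=
  let y := fresh (insert x R.letters)
  tauOf y (all x (equ (mem (var x) (var y)) R))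

/-- `T ⊂ U`. -/
def sub (T U : Term) : Relation :=
  let z := fresh (T.letters ∪ U.letters)
  all z (imp (mem (var z) T) (mem (var z) U))

/-- The empty set, `τ_X((∀x)(x ∉ X))`. -/
def empty : Term := tauOf 0 (all 1 (not (mem (var 1) (var 0))))

/-- `{T, U}`. -/
def pair (T U : Term) : Term :=
  let z := fresh (T.letters ∪ U.letters)
  setOf z (or (eq (var z) T) (eq (var z) U))

/-- `{T}`. -/
def singleton (T : Term) : Term := pair T T

/-- The ordered pair `(T, U)`. -/
def opair (T U : Term) : Term := pair (singleton T) (pair T U)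

/-- `T ∪ U`. -/
def union (T U : Term) : Term :=
  let z := fresh (T.letters ∪ U.letters)
  setOf z (or (mem (var z) T) (mem (var z) U))

/-- `T × U`. -/
def prod (T U : Term) : Term :=
  let z := fresh (T.letters ∪ U.letters)
  let x := z + 1
  let y := z + 2
  setOf z (ex x (ex y (conj (eq (var z) (opair (var x) (var y)))
    (conj (mem (var x) T) (mem (var y) U)))))

/-- `Eq(T, U)`: there is a bijection of `T` onto `U` (`g` is its graph). -/
def equipotent (T U : Term) : Relation :=
  let g := fresh (T.letters ∪ U.letters)
  let x := g + 1
  let y := g + 2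
  ex g (conj (sub (var g) (prod T U)) (conj
    (all x (imp (mem (var x) T) (exUnique y (mem (opair (var x) (var y)) (var g)))))
    (all y (imp (mem (var y) U) (exUnique x (mem (opair (var x) (var y)) (var g)))))))

/-- The cardinal of `T`, `τ_Z(Eq(T, Z))`. -/
def card (T : Term) : Term :=
  let z := fresh T.letters
  tauOf z (equipotent T (var z))

/-- The cardinal `1`. -/
def one : Term := card (singleton empty)

/-- The cardinal sum `T + U`: the cardinal of the disjoint union of `T` and `U`. -/
def add (T U : Term) : Term :=
  card (union (prod T (singleton empty)) (prod U (singleton (singleton empty))))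

/-- `T` is a finite set: its cardinal `a` satisfies `a ≠ a + 1`. -/
def finite (T : Term) : Relation := ne (card T) (add (card T) one)

/-- The axioms of the theory of sets: all relations given by the schemes S1 to S8 and the explicit
axioms of extent, of the two-element set, of the set of subsets, and of infinity. -/
inductive IsAxiom : Relation → Prop
  | s1 (R : Relation) : IsAxiom (imp (or R R) R)
  | s2 (R S : Relation) : IsAxiom (imp R (or R S))
  | s3 (R S : Relation) : IsAxiom (imp (or R S) (or S R))
  | s4 (R S Q : Relation) : IsAxiom (imp (imp R S) (imp (or Q R) (or Q S)))
  | s5 (R : Relation) (T : Term) (x : ℕ) : IsAxiom (imp (subst T x R) (ex x R))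
  | s6 (R : Relation) (T U : Term) (x : ℕ) :
      IsAxiom (imp (eq T U) (equ (subst T x R) (subst U x R)))
  | s7 (R S : Relation) (x : ℕ) :
      IsAxiom (imp (all x (equ R S)) (eq (tauOf x R) (tauOf x S)))
  | s8 (R : Relation) (x y X Y : ℕ) (hxy : x ≠ y) (hXx : X ≠ x) (hXy : X ≠ y) (hYx : Y ≠ x)
      (hYy : Y ≠ y) (hX : X ∉ R.letters) (hY : Y ∉ R.letters) :
      IsAxiom (imp (all y (ex X (all x (imp R (mem (var x) (var X))))))
        (all Y (coll x (ex y (conj (mem (var y) (var Y)) R)))))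
  | extent : IsAxiom (all 0 (all 1
      (imp (conj (sub (var 0) (var 1)) (sub (var 1) (var 0))) (eq (var 0) (var 1)))))
  | two : IsAxiom (all 0 (all 1 (coll 2 (or (eq (var 2) (var 0)) (eq (var 2) (var 1))))))
  | subsets : IsAxiom (all 0 (coll 1 (sub (var 1) (var 0))))
  | infinity : IsAxiom (ex 0 (not (finite (var 0))))

/-- The theorems of the theory of sets: the relations obtained from axioms by detachment
(from `R` and `R ⇒ S` infer `S`). -/
inductive IsTheorem : Relation → Prop
  | of_axiom {R : Relation} (h : IsAxiom R) : IsTheorem R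
  | detach {R S : Relation} (h : IsTheorem R) (h' : IsTheorem (imp R S)) : IsTheorem S

/-- A relation is undecidable if it is neither true nor false, that is, if neither it nor its
negation is a theorem. -/
def Undecidable (R : Relation) : Prop := ¬ IsTheorem R ∧ ¬ IsTheorem (not R)

end Bourbaki

/-! The theory is interpreted in `ZFSet`: letters denote sets, and `τ_x(R)` denotes `c P`, where `P`
is the class of all `a` satisfying `R` and `c` is an operator on classes. If `c` picks an element of
every nonempty class, all axioms hold: S5 because `∃` as defined through `τ` then has its usual
meaning (`holds_ex`), S7 because `c` sees only the extension of a relation, the others by the usual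
facts about sets. Hence every theorem holds for every such `c` (`IsTheorem.holds`).

The value `c ∅` is unconstrained. Since `x = x` defines the universal class and `x ≠ x` the empty
one, the relation in question says `c Set.univ = c ∅`. With `c` fixed on nonempty classes, `c ∅` can
be chosen to make it true or false, so neither it nor its negation is a theorem. -/

namespace Bourbaki

open Assembly Function

/-! ### Interpretation of assemblies; substitution and linking -/

/-- The values of assemblies: a term denotes a set, a relation denotes a proposition. -/
def Kind.Value : Kind → Type 1
  | Kind.term => ZFSet.{0}
  | Kind.relation => ULift.{1} Prop

/-- The sequence `a, β 0, β 1, …`. -/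
def push (a : ZFSet.{0}) (β : ℕ → ZFSet.{0}) : ℕ → ZFSet.{0}
  | 0 => a
  | i + 1 => β i

/-- The value of an assembly in the universe of sets, where `τ` denotes the operator `c`, the
letters are given by `ρ` and the boxes that are linked to missing `τ`s by `β`. -/
def eval (c : Set ZFSet.{0} → ZFSet.{0}) (ρ : ℕ → ZFSet.{0}) :
    {k : Kind} → {n : ℕ} → Assembly k n → (ℕ → ZFSet.{0}) → k.Value
  | _, _, letter x, _ => ρ x
  | _, _, box i, β => β i
  | _, _, tau R, β => c {a | (eval c ρ R (push a β)).down}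
  | _, _, .or R S, β => ⟨(eval c ρ R β).down ∨ (eval c ρ S β).down⟩
  | _, _, .not R, β => ⟨¬ (eval c ρ R β).down⟩
  | _, _, eq T U, β => ⟨(show ZFSet.{0} from eval c ρ T β) = eval c ρ U β⟩
  | _, _, mem T U, β => ⟨(show ZFSet.{0} from eval c ρ T β) ∈ (show ZFSet.{0} from eval c ρ U β)⟩

variable {c : Set ZFSet.{0} → ZFSet.{0}}

theorem eval_congr {k : Kind} {n : ℕ} (A : Assembly k n) {ρ ρ' β β' : ℕ → ZFSet.{0}}
    (hρ : ∀ x ∈ A.letters, ρ x = ρ' x) (hβ : ∀ i < n, β i = β' i) :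
    eval c ρ A β = eval c ρ' A β' := by
  induction A generalizing β β' with
  | letter x => exact hρ x (by simp [letters])
  | box i => exact hβ i i.isLt
  | tau R ih =>
    have h (a : ZFSet.{0}) : eval c ρ R (push a β) = eval c ρ' R (push a β') := by
      refine ih hρ fun i hi => ?_
      cases i with
      | zero => rfl
      | succ i => exact hβ i (by omega)
    simp only [eval, h]
    rfl
  | not R ih =>
    simp only [eval, ih hρ hβ]
    rfl
  | or R S ihR ihS | eq R S ihR ihS | mem R S ihR ihS =>
    simp only [letters, Finset.mem_union] at hρ
    simp only [eval, ihR (fun x hx => hρ x (Or.inl hx)) hβ,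
      ihS (fun x hx => hρ x (Or.inr hx)) hβ]
    rfl

theorem eval_lift {k : Kind} {n m : ℕ} (h : n ≤ m) (A : Assembly k n) (ρ β : ℕ → ZFSet.{0}) :
    eval c ρ (lift h A) β = eval c ρ A β := by
  induction A generalizing m β with
  | letter x => rfl
  | box i => rfl
  | tau R ih =>
    simp only [lift, eval, ih]
    rfl
  | not R ih =>
    simp only [lift, eval, ih]
    rfl
  | or R S ihR ihS | eq R S ihR ihS | mem R S ihR ihS =>
    simp only [lift, eval, ihR, ihS]
    rfl

/-- The new `τ` lies outside the `n` enclosing ones, so its value sits at index `n` of `β`; under a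
further `τ`, `push` shifts it to `n + 1`. -/
theorem eval_link (x : ℕ) {k : Kind} {n : ℕ} (A : Assembly k n) (ρ β : ℕ → ZFSet.{0}) :
    eval c ρ (link x A) β = eval c (update ρ x (β n)) A β := by
  induction A generalizing β with
  | @letter n y =>
    by_cases h : y = x
    · subst h
      simp [link, eval]
      rfl
    · simp [link, eval, h]
      rfl
  | box i => rfl
  | tau R ih =>
    simp only [link, eval, ih]
    rfl
  | not R ih =>
    simp only [link, eval, ih]
    rfl
  | or R S ihR ihS | eq R S ihR ihS | mem R S ihR ihS =>
    simp only [link, eval, ihR, ihS]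
    rfl

/-- The value of a term. -/
def value (c : Set ZFSet.{0} → ZFSet.{0}) (T : Term) (ρ : ℕ → ZFSet.{0}) : ZFSet.{0} :=
  eval c ρ T fun _ => ∅

/-- The truth of a relation. -/
def Holds (c : Set ZFSet.{0} → ZFSet.{0}) (R : Relation) (ρ : ℕ → ZFSet.{0}) : Prop :=
  (eval c ρ R fun _ => ∅).down

theorem eval_eq_value (T : Term) (ρ β : ℕ → ZFSet.{0}) : eval c ρ T β = value c T ρ :=
  eval_congr T (fun _ _ => rfl) (by simp)

theorem eval_down_iff (R : Relation) (ρ β : ℕ → ZFSet.{0}) :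
    (eval c ρ R β).down ↔ Holds c R ρ := by
  rw [Holds, eval_congr R (fun _ _ => rfl) (by simp)]

/-- No capture can occur: `T` has no unlinked box, so its value is the same under any enclosing
`τ`s. -/
theorem eval_subst (T : Term) (x : ℕ) {k : Kind} {n : ℕ} (A : Assembly k n)
    (ρ β : ℕ → ZFSet.{0}) :
    eval c ρ (subst T x A) β = eval c (update ρ x (value c T ρ)) A β := by
  induction A generalizing β with
  | @letter n y =>
    by_cases h : y = x
    · subst h
      simp [subst, eval, eval_lift, eval_eq_value]
      rfl
    · simp [subst, eval, h]
      rfl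
  | box i => rfl
  | tau R ih =>
    simp only [subst, eval, ih]
    rfl
  | not R ih =>
    simp only [subst, eval, ih]
    rfl
  | or R S ihR ihS | eq R S ihR ihS | mem R S ihR ihS =>
    simp only [subst, eval, ihR, ihS]
    rfl

section Connectives

variable (ρ : ℕ → ZFSet.{0}) (R S : Relation) (T U : Term) (x : ℕ)

@[simp] theorem value_var : value c (var x) ρ = ρ x := rfl

@[simp] theorem holds_or : Holds c (or R S) ρ ↔ Holds c R ρ ∨ Holds c S ρ := Iff.rfl

@[simp] theorem holds_not : Holds c (not R) ρ ↔ ¬ Holds c R ρ := Iff.rfl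

@[simp] theorem holds_eq : Holds c (eq T U) ρ ↔ value c T ρ = value c U ρ := Iff.rfl

@[simp] theorem holds_mem : Holds c (mem T U) ρ ↔ value c T ρ ∈ value c U ρ := Iff.rfl

@[simp] theorem holds_ne : Holds c (ne T U) ρ ↔ value c T ρ ≠ value c U ρ := Iff.rfl

@[simp] theorem holds_imp : Holds c (imp R S) ρ ↔ (Holds c R ρ → Holds c S ρ) := by
  simp only [imp, holds_or, holds_not]
  tauto

@[simp] theorem holds_conj : Holds c (conj R S) ρ ↔ Holds c R ρ ∧ Holds c S ρ := by
  simp only [conj, holds_or, holds_not]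
  tauto

@[simp] theorem holds_equ : Holds c (equ R S) ρ ↔ (Holds c R ρ ↔ Holds c S ρ) := by
  simp only [equ, holds_conj, holds_imp]
  tauto

@[simp] theorem holds_subst : Holds c (subst T x R) ρ ↔ Holds c R (update ρ x (value c T ρ)) := by
  rw [Holds, eval_subst, Holds]

@[simp] theorem value_tauOf : value c (tauOf x R) ρ = c {a | Holds c R (update ρ x a)} := by
  simp only [value, tauOf, eval, eval_link, eval_down_iff]
  rfl

variable {ρ R T x}

theorem holds_update (h : x ∉ letters R) (a : ZFSet.{0}) :
    Holds c R (update ρ x a) ↔ Holds c R ρ := by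
  rw [Holds, Holds, eval_congr R (fun y hy => ?_) fun _ _ => rfl]
  exact update_of_ne (fun (e : y = x) => h (e ▸ hy)) _ _

theorem value_update (h : x ∉ letters T) (a : ZFSet.{0}) :
    value c T (update ρ x a) = value c T ρ :=
  eval_congr T (fun y hy => update_of_ne (fun (e : y = x) => h (e ▸ hy)) _ _) fun _ _ => rfl

end Connectives

/-- `fresh s` exceeds every element of `s`, so `fresh s + 1` and `fresh s + 2` are new letters too.
-/
theorem notMem_of_fresh_le {s : Finset ℕ} {x : ℕ} (h : fresh s ≤ x) : x ∉ s := fun hx => by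
  have := Finset.le_sup (f := id) hx
  simp only [fresh, id] at h this
  omega

theorem notMem_union_of_fresh_le {s t : Finset ℕ} {x : ℕ} (h : fresh (s ∪ t) ≤ x) :
    x ∉ s ∧ x ∉ t := by
  simpa [not_or] using notMem_of_fresh_le h

theorem notMem_insert_of_fresh_le {s : Finset ℕ} {x y : ℕ} (h : fresh (insert y s) ≤ x) :
    x ≠ y ∧ x ∉ s := by
  simpa [not_or] using notMem_of_fresh_le h

/-- `c` chooses an element in every nonempty class. -/
def IsChoice (c : Set ZFSet.{0} → ZFSet.{0}) : Prop := ∀ P : Set ZFSet.{0}, P.Nonempty → c P ∈ P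

/-- A bijection between two sets is given by its graph. -/
theorem _root_.ZFSet.nonempty_equiv_iff {s t : ZFSet.{0}} :
    Nonempty (s ≃ t) ↔ ∃ g : ZFSet.{0}, g ⊆ s.prod t ∧
      (∀ a ∈ s, ∃! b, a.pair b ∈ g) ∧ ∀ b ∈ t, ∃! a, ZFSet.pair a b ∈ g := by
  constructor
  · rintro ⟨e⟩
    refine ⟨(s.prod t).sep fun p => ∃ a : s, p = a.1.pair (e a).1,
      fun p hp => (ZFSet.mem_sep.1 hp).1, fun a ha => ⟨e ⟨a, ha⟩, ?_, ?_⟩,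
      fun b hb => ⟨e.symm ⟨b, hb⟩, ?_, ?_⟩⟩
    · exact ZFSet.mem_sep.2 ⟨ZFSet.pair_mem_prod.2 ⟨ha, (e _).2⟩, ⟨a, ha⟩, rfl⟩
    · intro b hb
      obtain ⟨-, ⟨a', ha'⟩, h⟩ := ZFSet.mem_sep.1 hb
      obtain ⟨rfl, rfl⟩ := ZFSet.pair_inj.1 h
      rfl
    · exact ZFSet.mem_sep.2 ⟨ZFSet.pair_mem_prod.2 ⟨(e.symm _).2, hb⟩, e.symm ⟨b, hb⟩, by simp⟩
    · intro a ha
      obtain ⟨-, ⟨a', ha'⟩, h⟩ := ZFSet.mem_sep.1 ha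
      obtain ⟨rfl, rfl⟩ := ZFSet.pair_inj.1 h
      simp
  · rintro ⟨g, hg, h₁, h₂⟩
    choose f hf hf' using h₁
    choose k hk hk' using h₂
    have hft (a) (ha : a ∈ s) : f a ha ∈ t := (ZFSet.pair_mem_prod.1 (hg (hf a ha))).2
    have hks (b) (hb : b ∈ t) : k b hb ∈ s := (ZFSet.pair_mem_prod.1 (hg (hk b hb))).1
    exact ⟨⟨fun a => ⟨f a.1 a.2, hft _ _⟩, fun b => ⟨k b.1 b.2, hks _ _⟩,
      fun a => Subtype.ext (hk' _ _ _ (hf _ _)).symm,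
      fun b => Subtype.ext (hf' _ _ _ (hk _ _)).symm⟩⟩

/-! ### Meaning of quantifiers and set constructions under a choice operator -/

section Quantifiers

variable (hc : IsChoice c) (ρ : ℕ → ZFSet.{0}) (R : Relation) (T U : Term) (x : ℕ)

include hc

/-- A witness makes the class nonempty, and `c` then selects a member of it; this is where the
choice property enters. -/
theorem holds_ex : Holds c (ex x R) ρ ↔ ∃ a, Holds c R (update ρ x a) := by
  rw [ex, holds_subst, value_tauOf]
  exact ⟨fun h => ⟨_, h⟩, fun h => hc {a | Holds c R (update ρ x a)} h⟩

theorem holds_all : Holds c (all x R) ρ ↔ ∀ a, Holds c R (update ρ x a) := by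
  simp [all, holds_ex hc]

theorem holds_exUnique : Holds c (exUnique x R) ρ ↔ ∃! a, Holds c R (update ρ x a) := by
  unfold exUnique
  extract_lets y z
  obtain ⟨hyx, hyR⟩ := notMem_insert_of_fresh_le (le_refl y)
  obtain ⟨hzy, hz⟩ := notMem_insert_of_fresh_le (le_refl z)
  obtain ⟨hzx, hzR⟩ : z ≠ x ∧ z ∉ R.letters := by simpa [not_or] using hz
  have key (a b d : ZFSet.{0}) : Holds c R (update (update (update ρ y a) z b) x d) ↔
      Holds c R (update ρ x d) := by
    rw [update_comm hzx, holds_update hzR, update_comm hyx, holds_update hyR]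
  simp only [holds_conj, holds_ex hc, holds_all hc, holds_imp, holds_subst, holds_eq, value_var,
    key, update_self, update_of_ne hzy.symm]
  exact ⟨fun ⟨⟨a, ha⟩, h⟩ => ⟨a, ha, fun b hb => h b a ⟨hb, ha⟩⟩,
    fun h => ⟨h.exists, fun a b hab => h.unique hab.1 hab.2⟩⟩

theorem holds_coll : Holds c (coll x R) ρ ↔
    ∃ s : ZFSet.{0}, ∀ a, a ∈ s ↔ Holds c R (update ρ x a) := by
  unfold coll
  extract_lets y
  obtain ⟨hyx, hyR⟩ := notMem_insert_of_fresh_le (le_refl y)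
  simp only [holds_ex hc, holds_all hc, holds_equ, holds_mem, value_var, update_self,
    update_of_ne hyx.symm, update_comm hyx, holds_update hyR]

variable {ρ R x} in
-- The class from which `c` chooses is nonempty, and by extensionality `s` is its only member.
theorem value_setOf {s : ZFSet.{0}} (h : ∀ a, a ∈ s ↔ Holds c R (update ρ x a)) :
    value c (setOf x R) ρ = s := by
  unfold setOf
  extract_lets y
  obtain ⟨hyx, hyR⟩ := notMem_insert_of_fresh_le (le_refl y)
  simp only [value_tauOf, holds_all hc, holds_equ, holds_mem, value_var, update_self,
    update_of_ne hyx.symm, update_comm hyx, holds_update hyR]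
  have := hc {t : ZFSet.{0} | ∀ a, a ∈ t ↔ Holds c R (update ρ x a)} ⟨s, h⟩
  exact ZFSet.ext fun a => (this a).trans (h a).symm

theorem holds_sub : Holds c (sub T U) ρ ↔ value c T ρ ⊆ value c U ρ := by
  unfold sub
  extract_lets z
  obtain ⟨hT, hU⟩ := notMem_union_of_fresh_le (le_refl z)
  simp only [holds_all hc, holds_imp, holds_mem, value_var, update_self, value_update hT,
    value_update hU]
  rfl

theorem value_pair : value c (pair T U) ρ = {value c T ρ, value c U ρ} := by
  unfold pair
  extract_lets z
  obtain ⟨hT, hU⟩ := notMem_union_of_fresh_le (le_refl z)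
  exact value_setOf hc fun a => by simp [value_update hT, value_update hU]

theorem value_singleton : value c (singleton T) ρ = {value c T ρ} := by
  rw [singleton, value_pair hc]
  ext
  simp

theorem value_opair : value c (opair T U) ρ = (value c T ρ).pair (value c U ρ) := by
  rw [opair, value_pair hc, value_singleton hc, value_pair hc, ZFSet.pair]

theorem value_union : value c (union T U) ρ = value c T ρ ∪ value c U ρ := by
  unfold union
  extract_lets z
  obtain ⟨hT, hU⟩ := notMem_union_of_fresh_le (le_refl z)
  exact value_setOf hc fun a => by simp [value_update hT, value_update hU]

theorem value_prod : value c (prod T U) ρ = (value c T ρ).prod (value c U ρ) := by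
  unfold prod
  extract_lets z x y
  obtain ⟨hzT, hzU⟩ := notMem_union_of_fresh_le (le_refl z)
  obtain ⟨hxT, hxU⟩ := notMem_union_of_fresh_le (show z ≤ x by omega)
  obtain ⟨hyT, hyU⟩ := notMem_union_of_fresh_le (show z ≤ y by omega)
  have hzx : z ≠ x := by omega
  have hzy : z ≠ y := by omega
  have hxy : x ≠ y := by omega
  refine value_setOf hc fun a => ?_
  simp only [holds_ex hc, holds_conj, holds_eq, holds_mem, value_opair hc, value_var, update_self,
    update_of_ne hzx, update_of_ne hzy, update_of_ne hxy, value_update hyT, value_update hyU,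
    value_update hxT, value_update hxU, value_update hzT, value_update hzU, ZFSet.mem_prod]
  exact ⟨fun ⟨p, hp, q, hq, h⟩ => ⟨p, q, h, hp, hq⟩, fun ⟨p, q, h, hp, hq⟩ => ⟨p, hp, q, hq, h⟩⟩

theorem holds_equipotent : Holds c (equipotent T U) ρ ↔
    Nonempty (value c T ρ ≃ value c U ρ) := by
  rw [ZFSet.nonempty_equiv_iff]
  unfold equipotent
  extract_lets g x y
  obtain ⟨hgT, hgU⟩ := notMem_union_of_fresh_le (le_refl g)
  obtain ⟨hxT, hxU⟩ := notMem_union_of_fresh_le (show g ≤ x by omega)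
  obtain ⟨hyT, hyU⟩ := notMem_union_of_fresh_le (show g ≤ y by omega)
  have hgx : g ≠ x := by omega
  have hgy : g ≠ y := by omega
  have hxy : x ≠ y := by omega
  simp only [holds_ex hc, holds_all hc, holds_exUnique hc, holds_conj, holds_imp, holds_sub hc,
    holds_mem, value_prod hc, value_opair hc, value_var, update_self, update_of_ne hgx,
    update_of_ne hgy, update_of_ne hxy, update_of_ne hxy.symm, value_update hgT,
    value_update hgU, value_update hxT, value_update hyU]

theorem value_card : value c (card T) ρ =
    c {s | Nonempty (value c T ρ ≃ s)} := by
  unfold card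
  extract_lets z
  have hz : z ∉ T.letters := notMem_of_fresh_le (le_refl z)
  simp only [value_tauOf, holds_equipotent hc, value_var, update_self, value_update hz]

theorem nonempty_equiv_value_card :
    Nonempty (value c T ρ ≃ value c (card T) ρ) := by
  rw [value_card hc]
  exact hc {s | Nonempty (value c T ρ ≃ s)} ⟨_, ⟨Equiv.refl _⟩⟩

variable {T U} in
-- Equipotent sets are equipotent to the same sets, so `c` is applied to the same class: the
-- cardinals are equal, not merely equipotent.
theorem value_card_congr (h : Nonempty (value c T ρ ≃ value c U ρ)) :
    value c (card T) ρ = value c (card U) ρ := by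
  obtain ⟨e⟩ := h
  simp only [value_card hc]
  congr 1
  ext s
  exact ⟨fun ⟨f⟩ => ⟨e.symm.trans f⟩, fun ⟨f⟩ => ⟨e.trans f⟩⟩

end Quantifiers

/-! ### Countably infinite sets -/

theorem _root_.ZFSet.exists_countable_infinite :
    ∃ s : ZFSet.{0}, (s : Set ZFSet.{0}).Countable ∧ (s : Set ZFSet.{0}).Infinite := by
  -- The finite von Neumann ordinals, told apart by their ranks.
  let f (n : ℕ) : ZFSet.{0} := (n : Ordinal.{0}).toZFSet
  have hf : Injective f := fun m n h => by simpa [f] using congrArg ZFSet.rank h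
  refine ⟨ZFSet.range f, ?_, ?_⟩
  · simpa using Set.countable_range f
  · simpa using Set.infinite_range_of_injective hf

theorem _root_.ZFSet.countable_prod {s t : ZFSet.{0}} (hs : (s : Set ZFSet.{0}).Countable)
    (ht : (t : Set ZFSet.{0}).Countable) : (s.prod t : Set ZFSet.{0}).Countable := by
  refine (hs.image2 ht ZFSet.pair).mono fun p hp => ?_
  obtain ⟨a, ha, b, hb, rfl⟩ := ZFSet.mem_prod.1 hp
  exact ⟨a, ha, b, hb, rfl⟩

theorem _root_.ZFSet.infinite_prod {s t : ZFSet.{0}} (hs : (s : Set ZFSet.{0}).Infinite)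
    {b : ZFSet.{0}} (hb : b ∈ t) : (s.prod t : Set ZFSet.{0}).Infinite := by
  refine (hs.image (f := fun a => a.pair b) fun _ _ _ _ h => (ZFSet.pair_inj.1 h).1).mono ?_
  rintro _ ⟨a, ha, rfl⟩
  exact ZFSet.pair_mem_prod.2 ⟨ha, hb⟩

theorem _root_.ZFSet.nonempty_equiv_of_countable_of_infinite {s t : ZFSet.{0}}
    (hs : (s : Set ZFSet.{0}).Countable) (hs' : (s : Set ZFSet.{0}).Infinite)
    (ht : (t : Set ZFSet.{0}).Countable) (ht' : (t : Set ZFSet.{0}).Infinite) :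
    Nonempty (s ≃ t) := by
  have := hs.to_subtype
  have := ht.to_subtype
  have := hs'.to_subtype
  have := ht'.to_subtype
  exact nonempty_equiv_of_countable (α := (s : Set ZFSet.{0})) (β := (t : Set ZFSet.{0}))

/-! ### Soundness -/

section Soundness

variable (hc : IsChoice c)

include hc

/-- Adding a countable set to a countably infinite one leaves it countably infinite, so `a = a + 1`
for its cardinal `a`. -/
theorem not_holds_finite {T : Term} {ρ : ℕ → ZFSet.{0}}
    (hT : (value c T ρ : Set ZFSet.{0}).Countable)
    (hT' : (value c T ρ : Set ZFSet.{0}).Infinite) : ¬ Holds c (finite T) ρ := by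
  rw [finite, holds_ne, not_not, add]
  refine value_card_congr hc ρ ?_
  have countable_card {U : Term} (hU : (value c U ρ : Set ZFSet.{0}).Countable) :
      (value c (card U) ρ : Set ZFSet.{0}).Countable := by
    obtain ⟨e⟩ := nonempty_equiv_value_card hc ρ U
    have := hU.to_subtype
    exact Set.countable_coe_iff.1 (e.symm.injective.countable (α := value c (card U) ρ))
  have infinite_card : (value c (card T) ρ : Set ZFSet.{0}).Infinite := by
    obtain ⟨e⟩ := nonempty_equiv_value_card hc ρ T
    have := hT'.to_subtype
    exact Set.infinite_coe_iff.1 (Infinite.of_injective (β := value c T ρ)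
      (α := value c (card T) ρ) e e.injective)
  -- Countability of `1` suffices: the first summand already makes the union infinite.
  have countable_one : (value c one ρ : Set ZFSet.{0}).Countable :=
    countable_card (by simp [value_singleton hc])
  refine ZFSet.nonempty_equiv_of_countable_of_infinite hT hT' ?_ ?_ <;>
    simp only [value_union hc, value_prod hc, value_singleton hc, ZFSet.coe_union]
  · exact (ZFSet.countable_prod (countable_card hT) (by simp)).union
      (ZFSet.countable_prod countable_one (by simp))
  · exact (ZFSet.infinite_prod infinite_card (ZFSet.mem_singleton.2 rfl)).mono
      Set.subset_union_left

theorem IsAxiom.holds {R : Relation} (h : IsAxiom R) (ρ : ℕ → ZFSet.{0}) : Holds c R ρ := by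
  cases h with
  | s1 R => simp
  | s2 R S => simpa using Or.inl
  | s3 R S => simpa using Or.symm
  | s4 R S Q =>
    simp only [holds_imp, holds_or]
    exact fun h => Or.imp_right h
  | s5 R T x =>
    simp only [holds_imp, holds_subst, holds_ex hc]
    exact fun h => ⟨_, h⟩
  | s6 R T U x =>
    simp only [holds_imp, holds_equ, holds_eq, holds_subst]
    intro h
    rw [h]
  | s7 R S x =>
    simp only [holds_imp, holds_equ, holds_eq, holds_all hc, value_tauOf]
    intro h
    simp only [h]
  | s8 R x y X Y hxy hXx hXy hYx hYy hX hY =>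
    simp only [holds_imp, holds_all hc, holds_ex hc, holds_coll hc, holds_conj, holds_mem,
      value_var]
    intro h s
    choose f hf using h
    -- The bounding sets `f b` for `b ∈ s` are united, and separation removes the superfluous
    -- elements.
    refine ⟨(ZFSet.iUnion fun b : s => f b).sep fun a =>
      ∃ b ∈ s, Holds c R (update (update ρ x a) y b), fun a => ?_⟩
    simp only [update_self, update_of_ne hYy, update_comm hYx, update_comm hYy, holds_update hY]
    rw [ZFSet.mem_sep, ZFSet.mem_iUnion]
    refine ⟨fun h => h.2, fun h => ⟨?_, h⟩⟩
    obtain ⟨b, hb, hR⟩ := h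
    have := hf b a
    simp only [update_self, update_of_ne hXx, update_comm hXx, holds_update hX,
      update_comm hxy.symm] at this
    exact ⟨⟨b, hb⟩, this hR⟩
  | extent =>
    simp only [holds_imp, holds_all hc, holds_conj, holds_sub hc, holds_eq, value_var]
    exact fun a b h => ZFSet.ext fun z => ⟨fun hz => h.1 hz, fun hz => h.2 hz⟩
  | two =>
    simp only [holds_all hc, holds_coll hc, holds_or, holds_eq, value_var]
    exact fun a b => ⟨{a, b}, fun z => by simp⟩
  | subsets =>
    simp only [holds_all hc, holds_coll hc, holds_sub hc, value_var]
    exact fun a => ⟨a.powerset, fun z => by simp⟩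
  | infinity =>
    obtain ⟨s, hs, hs'⟩ := ZFSet.exists_countable_infinite
    simp only [holds_ex hc, holds_not]
    exact ⟨s, not_holds_finite hc (by simpa using hs) (by simpa using hs')⟩

theorem IsTheorem.holds {R : Relation} (h : IsTheorem R) (ρ : ℕ → ZFSet.{0}) : Holds c R ρ := by
  induction h with
  | of_axiom h => exact h.holds hc ρ
  | detach _ _ ih ih' => exact (holds_imp ρ _ _).1 ih' ih

end Soundness

/-- For every set `d` there is a choice operator with value `d` at the empty class, whose value at
the universal class does not depend on `d`. -/
theorem exists_isChoice : ∃ u : ZFSet.{0}, ∀ d : ZFSet.{0},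
    ∃ c, IsChoice c ∧ c Set.univ = u ∧ c ∅ = d := by
  classical
  refine ⟨(Set.univ_nonempty (α := ZFSet.{0})).some, fun d =>
    ⟨fun P => if h : P.Nonempty then h.some else d, fun P hP => ?_, ?_, ?_⟩⟩
  · simpa only [dif_pos hP] using hP.some_mem
  · simp only [Set.univ_nonempty, dif_pos]
  · simp

theorem holds_tauOf_eq_tauOf (x : ℕ) (ρ : ℕ → ZFSet.{0}) :
    Holds c (eq (tauOf x (eq (var x) (var x))) (tauOf x (ne (var x) (var x)))) ρ ↔
      c Set.univ = c ∅ := by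
  simp

end Bourbaki

theorem mainTheorem2 (x : ℕ) :
    Bourbaki.Undecidable
      (Bourbaki.Assembly.eq
        (Bourbaki.tauOf x (Bourbaki.Assembly.eq (Bourbaki.var x) (Bourbaki.var x)))
        (Bourbaki.tauOf x (Bourbaki.ne (Bourbaki.var x) (Bourbaki.var x)))) := by
  obtain ⟨u, hu⟩ := Bourbaki.exists_isChoice
  constructor
  · intro h
    -- With `c ∅ = {u}`, equality would give `u = {u}`, hence `u ∈ u`, against foundation.
    obtain ⟨c, hc, hcu, hcd⟩ := hu {u}
    have := (Bourbaki.holds_tauOf_eq_tauOf x _).1 (h.holds hc fun _ => ∅)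
    rw [hcu, hcd] at this
    have hu' : u ∈ ({u} : ZFSet.{0}) := ZFSet.mem_singleton.2 rfl
    exact ZFSet.mem_irrefl u (by rwa [← this] at hu')
  · intro h
    -- With `c ∅ = u = c Set.univ` the relation holds, so its negation is not a theorem.
    obtain ⟨c, hc, hcu, hcd⟩ := hu u
    exact h.holds hc (fun _ => ∅) ((Bourbaki.holds_tauOf_eq_tauOf x _).2 (hcu.trans hcd.symm))
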